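/- Let $n\ge 1$. Let $X=\tilde{\mathcal O}_n$ be the set of lattice paths from $(0,i)$ to $(n,i)$, for some integer $i\ge 0$ (which may vary with the path), with steps $D=(1,-1)$, $H_1=H_2=(1,0)$, $U=(1,1)$ (where $H_1,H_2$ are two different labels for horizontal steps), that stay weakly above the $x$-axis and touch it in at least one point. Let $\mathbf r$ be the rotation by one unit to the right: if $p\in X$ has heights $h_0,\dots,h_n$ (with $h_n=h_0$) and steps $s_1,\dots,s_n$, then $\mathbf r(p)$ is the path with heights $h_{n-1},h_0,h_1,\dots,h_{n-1}$ and steps $s_n,s_1,\dots,s_{n-1}$. Let $C=\langle\mathbf r\rangle$ be the group of permutations of $X$ generated by $\mathbf r$, and let $\tilde O_n(q)=\sum_{p\in X}q^{\operatorname{area}(p)}\in\mathbb N[q]$, where $\operatorname{area}(p)=\sum_{k=1}^{n}\frac{h_{k-1}+h_k}{2}=\sum_{k=0}^{n-1}h_k$ is the area between $p$ and the $x$-axis. Write $\xi_n=e^{2\pi \mathrm i/n}$ and let $(n,j)$ denote the greatest common divisor of $n$ and $j$. Then $(X,C,\tilde O_n(q))$ exhibits the cyclic sieving phenomenon: $X$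 is finite, $C$ is cyclic of order $n$ with generator $\mathbf r$, and for every $j\in\{0,\dots,n-1\}$, $$\tilde O_n(\xi_n^j)=\bigl|\{p\in X:\mathbf r^j(p)=p\}\bigr| .$$ Moreover, for every $j\in\{0,\dots,n-1\}$ this number of fixed paths equals $\binom{2(n,j)}{(n,j)}$. -/

import Mathlib

open Polynomial

/-- The four steps; the two horizontal steps differ only by their label. -/
inductive PathStep : Type
  | D
  | H1
  | H2
  | U
  deriving DecidableEq

instance : Fintype PathStep :=
  ⟨{.D, .H1, .H2, .U}, fun s => by cases s <;> decide⟩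

/-- The vertical displacement of a step; the horizontal displacement is always 1. -/
def PathStep.rise : PathStep → ℤ
  | .D => -1
  | .H1 => 0
  | .H2 => 0
  | .U => 1

/-- Lattice paths of length `n` with steps `D`, `H1`, `H2`, `U` that end at their starting height,
stay (weakly) above the `x`-axis and touch it. The vertices of the path are `(k, height k)` for
`0 ≤ k ≤ n`; that the heights are natural numbers expresses that the path stays above the axis. -/
@[ext]
structure TouchingPath (n : ℕ) where
  height : Fin (n + 1) → ℕ
  step : Fin n → PathStep
  height_succ : ∀ k : Fin n, (height k.succ : ℤ) = height k.castSucc + (step k).rise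
  closed : height (Fin.last n) = height 0
  touches : ∃ k, height k = 0

namespace TouchingPath

variable {n : ℕ}

/-- A touching path is determined by its steps. -/
theorem step_injective : Function.Injective (step : TouchingPath n → Fin n → PathStep) := by
  intro p q h
  have key : ∀ k, (p.height k : ℤ) - q.height k = p.height 0 - q.height 0 := by
    intro k
    induction k using Fin.induction with
    | zero => rfl
    | succ i ih =>
      have h1 := p.height_succ i
      have h2 := q.height_succ i
      rw [h] at h1
      omega
  obtain ⟨a, ha⟩ := p.touches
  obtain ⟨b, hb⟩ := q.touches
  have h1 := key a
  have h2 := key b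
  refine TouchingPath.ext (funext fun k => ?_) h
  have h3 := key k
  omega

instance : Finite (TouchingPath n) := Finite.of_injective _ step_injective

noncomputable instance : Fintype (TouchingPath n) := Fintype.ofFinite _

/-- The area of the region between the path and the `x`-axis. It is computed as the sum of the
heights of the first `n` vertices; see `area_eq_sum_trapezoids`. -/
def area (p : TouchingPath n) : ℕ := ∑ k : Fin n, p.height k.castSucc

/-- `area` is the sum of the areas of the trapezoids below the `n` steps. -/
theorem area_eq_sum_trapezoids (p : TouchingPath n) :
    (p.area : ℚ) = ∑ k : Fin n, ((p.height k.castSucc : ℚ) + p.height k.succ) / 2 := by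
  have h1 := Fin.sum_univ_succ (fun k => (p.height k : ℚ))
  have h2 := Fin.sum_univ_castSucc (fun k => (p.height k : ℚ))
  rw [p.closed] at h2
  rw [← Finset.sum_div, Finset.sum_add_distrib, area]
  push_cast
  linarith

/-- The generating polynomial of touching paths of length `n` with respect to area. -/
noncomputable def areaPolynomial (n : ℕ) : ℕ[X] := ∑ p : TouchingPath n, X ^ p.area

/-- Read a path, drawn on a cylinder of circumference `n`, from its abscissa `c` on:
vertex and step number `k` of the new path are number `k + c` modulo `n` of the old one. -/
def cyclicShift [NeZero n] (c : ℕ) (p : TouchingPath n) : TouchingPath n where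
  height k := p.height (Fin.ofNat n (k + c)).castSucc
  step k := p.step (Fin.ofNat n (k + c))
  height_succ k := by
    have hn : 0 < n := Nat.pos_of_neZero n
    have h := p.height_succ (Fin.ofNat n (k + c))
    have e : p.height (Fin.ofNat n (k.succ + c)).castSucc
        = p.height (Fin.ofNat n (k + c)).succ := by
      have hlt : (k + c) % n < n := Nat.mod_lt _ hn
      have hm : (k.succ + c : ℕ) % n = ((k + c) % n + 1) % n := by
        rw [Nat.mod_add_mod, Fin.val_succ]
        congr 1
        omega
      rcases Nat.lt_or_ge ((k + c) % n + 1) n with h1 | h1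
      · congr 1
        apply Fin.ext
        simp only [Fin.val_castSucc, Fin.val_succ, Fin.val_ofNat] at hm ⊢
        rw [hm, Nat.mod_eq_of_lt h1]
      · have h2 : (k + c) % n + 1 = n := by omega
        have e1 : (Fin.ofNat n (k + c)).succ = Fin.last n := by
          apply Fin.ext
          simpa using h2
        have e2 : (Fin.ofNat n (k.succ + c)).castSucc = 0 := by
          apply Fin.ext
          simp only [Fin.val_castSucc, Fin.val_ofNat, Fin.val_zero]
          rw [hm, h2, Nat.mod_self]
        rw [e1, e2, p.closed]
    rw [e, h]
    rfl
  closed := by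
    congr 2
    apply Fin.ext
    simp
  touches := by
    have hn : 0 < n := Nat.pos_of_neZero n
    have h : ∃ k : Fin n, p.height k.castSucc = 0 := by
      obtain ⟨k, hk⟩ := p.touches
      induction k using Fin.lastCases with
      | last =>
        rw [p.closed] at hk
        exact ⟨⟨0, hn⟩, hk⟩
      | cast k => exact ⟨k, hk⟩
    obtain ⟨k, hk⟩ := h
    refine ⟨(Fin.ofNat n (k + (n - c % n))).castSucc, ?_⟩
    rw [← hk]
    congr 2
    apply Fin.ext
    have hc : c % n < n := Nat.mod_lt _ hn
    simp only [Fin.val_castSucc, Fin.val_ofNat, Nat.mod_add_mod]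
    rw [Nat.add_mod, ← Nat.mod_mod c n, ← Nat.add_mod,
      show (k : ℕ) + (n - c % n % n) + c % n = k + n by rw [Nat.mod_mod]; omega,
      Nat.add_mod_right, Nat.mod_eq_of_lt k.isLt]

theorem cyclicShift_cyclicShift [NeZero n] {c d : ℕ} (h : c + d = n) (p : TouchingPath n) :
    cyclicShift c (cyclicShift d p) = p := by
  apply step_injective
  funext k
  change p.step _ = p.step _
  congr 1
  apply Fin.ext
  simp only [Fin.val_ofNat, Nat.mod_add_mod]
  rw [Nat.add_assoc, h, Nat.add_mod_right, Nat.mod_eq_of_lt k.isLt]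

/-- The rotation of paths by one unit to the right: step `k` of the old path becomes step `k + 1`
of the new one, and the last step of the old path becomes the first step of the new one. -/
def rotation (n : ℕ) [NeZero n] : Equiv.Perm (TouchingPath n) where
  toFun := cyclicShift (n - 1)
  invFun := cyclicShift 1
  left_inv := cyclicShift_cyclicShift (by have := Nat.pos_of_neZero n; omega)
  right_inv := cyclicShift_cyclicShift (by have := Nat.pos_of_neZero n; omega)

/-- The group of rotations of touching paths, acting on them by evaluation. -/
abbrev rotationGroup (n : ℕ) [NeZero n] : Subgroup (Equiv.Perm (TouchingPath n)) :=
  Subgroup.zpowers (rotation n)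

/-- The rotation by one unit as the distinguished generator of the rotation group. -/
def rotationGen (n : ℕ) [NeZero n] : rotationGroup n :=
  ⟨rotation n, Subgroup.mem_zpowers _⟩

end TouchingPath

/-- The triple `(X, C, P)`, where `C` is a finite cyclic group of order `n` generated by `c` that
acts on the finite set `X` and `P` is a polynomial with natural coefficients, exhibits the cyclic
sieving phenomenon. -/
structure ExhibitsCyclicSieving (X : Type*) {C : Type*} [Group C] [MulAction C X]
    (c : C) (n : ℕ) (P : ℕ[X]) : Prop where
  finite : Finite X
  order_pos : 0 < n
  card_group : Nat.card C = n
  generates : Subgroup.zpowers c = ⊤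
  sieving : ∀ j < n, aeval (Complex.exp (2 * Real.pi * Complex.I / n) ^ j) P =
    (Nat.card (MulAction.fixedBy X (c ^ j)) : ℂ)

/-! A touching path is the same thing as a step sequence with total rise 0, since the starting
height is forced by the condition that the minimum be 0. By Abel summation the area is `n` times
that height minus `∑ k * rise k`. At `q ^ n = 1` the height therefore drops out, and the weight of a
path is a product over its steps (`area_eq`).

The sum over closed sequences is then the coefficient of `X ^ n` in `∏ (X + q ^ k) ^ 2 * q ^ (-k)`.
If `q` has order `d` and `n = d * g`, the product over one period collapses to a polynomial in `X ^
d`, and the coefficient becomes `(2 * g).choose g` (`coeff_prod_pathStep`).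

On the other side, a path fixed by the `j`-th power of the rotation is a repetition of a closed
sequence of length `g = n.gcd j` (`card_cyclicShift_eq_self`). The case `q = 1` counts these, again
giving `(2 * g).choose g`. Both sides agree because `ξ_n ^ j` has order `n / g`. -/

/-- The number of units by which a step rises above a down step. -/
def PathStep.level (s : PathStep) : ℕ := (s.rise + 1).toNat

theorem PathStep.level_eq (s : PathStep) : (s.level : ℤ) = s.rise + 1 := by
  cases s <;> rfl

theorem PathStep.sum_univ {M : Type*} [AddCommMonoid M] (f : PathStep → M) :
    ∑ s, f s = f .D + (f .H1 + (f .H2 + f .U)) := by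
  change ∑ s ∈ {PathStep.D, .H1, .H2, .U}, f s = _
  simp

/-! ### Step weights at a root of unity -/

theorem IsPrimitiveRoot.prod_range_X_add_C {R : Type*} [CommRing R] [IsDomain R] {q : R} {d : ℕ}
    (hq : IsPrimitiveRoot q d) (hd : 0 < d) :
    ∏ k ∈ Finset.range d, (X + C (q ^ k)) = X ^ d + C (-(-1) ^ d) := by
  have h := X_pow_sub_C_eq_prod hq hd (rfl : (-1 : R) ^ d = (-1) ^ d)
  simp only [mul_neg_one, map_neg, sub_neg_eq_add] at h ⊢
  rw [← h, sub_eq_add_neg]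

theorem IsPrimitiveRoot.prod_range_pow {R : Type*} [CommRing R] [IsDomain R] {q : R} {d : ℕ}
    (hq : IsPrimitiveRoot q d) (hd : 0 < d) : ∏ k ∈ Finset.range d, q ^ k = -(-1) ^ d := by
  have h := congrArg (eval 0) (hq.prod_range_X_add_C hd)
  simpa [eval_prod, hd.ne'] using h

theorem Finset.prod_range_mul_of_periodic {M : Type*} [CommMonoid M] {f : ℕ → M} {d : ℕ}
    (hf : Function.Periodic f d) (g : ℕ) :
    ∏ k ∈ Finset.range (d * g), f k = (∏ k ∈ Finset.range d, f k) ^ g := by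
  induction g with
  | zero => simp
  | succ g ih =>
    rw [Nat.mul_succ, Finset.prod_range_add, ih, pow_succ]
    congr 1
    refine Finset.prod_congr rfl fun k _ => ?_
    rw [add_comm, mul_comm]
    exact hf.nat_mul g k

/-- The generating polynomial of the four steps in position `k`, where a step `s` is weighted
by `q ^ (-k * s.rise)` and the exponent of `X` is the level. -/
theorem PathStep.sum_level {K : Type*} [Field K] {w : K} (hw : w ≠ 0) :
    ∑ s : PathStep, C (w ^ (-s.rise)) * X ^ s.level = (X + C w) ^ 2 * C w⁻¹ := by
  have h : (C w * C w⁻¹ : K[X]) = 1 := by rw [← C_mul, mul_inv_cancel₀ hw, C_1]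
  rw [PathStep.sum_univ]
  simp only [PathStep.level, PathStep.rise]
  norm_num [show Int.toNat 2 = 2 from rfl]
  linear_combination (-2 * X - C w) * h

/-- With `b = -(-1) ^ d`, one period of factors multiplies to `(X ^ d + b) ^ 2 * b⁻¹`, so the whole
product is `(X ^ d + b) ^ (2 * g) * b⁻¹ ^ g`. The middle binomial coefficient carries `b ^ g`, which
cancels. -/
theorem coeff_prod_pathStep {K : Type*} [Field K] {q : K} {d g : ℕ} (hd : 0 < d)
    (hq : IsPrimitiveRoot q d) :
    (∏ k : Fin (d * g), ∑ s : PathStep,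
      C ((q ^ (k : ℕ)) ^ (-s.rise)) * X ^ s.level).coeff (d * g) = ((2 * g).choose g : K) := by
  have hq0 : q ≠ 0 := hq.ne_zero hd.ne'
  simp_rw [fun k : ℕ => PathStep.sum_level (pow_ne_zero k hq0)]
  rw [Fin.prod_univ_eq_prod_range (fun k => (X + C (q ^ k)) ^ 2 * C (q ^ k)⁻¹),
    Finset.prod_range_mul_of_periodic (fun k => by simp [pow_add, hq.pow_eq_one]),
    Finset.prod_mul_distrib, Finset.prod_pow, hq.prod_range_X_add_C hd, ← map_prod,
    Finset.prod_inv_distrib, hq.prod_range_pow hd]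
  -- Only the invertibility of this sign matters from here on.
  have hb : (-(-1) ^ d : K) * -(-1) ^ d = 1 := by rw [neg_mul_neg, ← mul_pow]; simp
  generalize (-(-1) ^ d : K) = b at hb
  rw [mul_pow, ← pow_mul, ← C_pow, coeff_mul_C,
    show (X ^ d + C b : K[X]) = expand K d (X + C b) by simp, ← map_pow, mul_comm d g,
    coeff_expand_mul hd, coeff_X_add_C_pow, show 2 * g - g = g by omega]
  rw [mul_right_comm, ← mul_pow, mul_inv_cancel₀ (left_ne_zero_of_mul_eq_one hb), one_pow, one_mul]

/-- The weighted number of closed step sequences, at a root of unity. -/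
theorem sum_closed_steps {K : Type*} [Field K] {q : K} {d g : ℕ} (hd : 0 < d)
    (hq : IsPrimitiveRoot q d) :
    ∑ s : {s : Fin (d * g) → PathStep // ∑ k, (s k).rise = 0},
      q ^ (-∑ k : Fin (d * g), (k : ℤ) * (s.1 k).rise) = ((2 * g).choose g : K) := by
  have hq0 : q ≠ 0 := hq.ne_zero hd.ne'
  rw [← coeff_prod_pathStep hd hq, Fintype.prod_sum, finsetSum_coeff,
    ← Finset.sum_subtype (Finset.univ.filter fun s : Fin (d * g) → PathStep => ∑ k, (s k).rise = 0)
      (by simp) (fun s => q ^ (-∑ k : Fin (d * g), (k : ℤ) * (s k).rise)), Finset.sum_filter]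
  refine Finset.sum_congr rfl fun s _ => ?_
  have hlevel : ((∑ k, (s k).level : ℕ) : ℤ) = ∑ k, (s k).rise + (d * g : ℕ) := by
    simp [PathStep.level_eq, Finset.sum_add_distrib]
  rw [Finset.prod_mul_distrib, ← map_prod, Finset.prod_pow_eq_pow_sum, coeff_C_mul_X_pow]
  -- By `hlevel`, the exponent of `X` is `d * g` exactly when the rises sum to 0.
  refine if_congr (by omega) ?_ rfl
  rw [← Finset.sum_neg_distrib]
  induction (Finset.univ : Finset (Fin (d * g))) using Finset.induction_on with
  | empty => simp
  | insert a t ha ih =>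
    rw [Finset.sum_insert ha, Finset.prod_insert ha, zpow_add₀ hq0, ih, ← zpow_natCast, ← zpow_mul,
      mul_neg]

/-! ### Area and closed step sequences -/

namespace TouchingPath

variable {n : ℕ}

theorem sum_rise (p : TouchingPath n) : ∑ k, (p.step k).rise = 0 := by
  have h1 := Fin.sum_univ_succ (fun k => (p.height k : ℤ))
  have h2 := Fin.sum_univ_castSucc (fun k => (p.height k : ℤ))
  simp only [p.height_succ, Finset.sum_add_distrib, p.closed] at h1 h2
  linarith

/-- Abel summation. -/
theorem sum_mul_sub_eq (h : Fin (n + 1) → ℤ) :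
    ∑ k : Fin n, (k + 1 : ℤ) * (h k.succ - h k.castSucc) =
      n * h (Fin.last n) - ∑ k : Fin n, h k.castSucc := by
  induction n with
  | zero => simp
  | succ n ih =>
    have := ih (fun k => h k.castSucc)
    rw [Fin.sum_univ_castSucc, Fin.sum_univ_castSucc (fun k => h k.castSucc)]
    simp only [Fin.val_castSucc, Fin.val_last, Fin.succ_castSucc, Fin.succ_last] at this ⊢
    rw [this]
    push_cast
    ring

theorem area_eq (p : TouchingPath n) :
    (p.area : ℤ) = n * p.height (Fin.last n) - ∑ k : Fin n, (k : ℤ) * (p.step k).rise := by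
  have h := sum_mul_sub_eq fun k => (p.height k : ℤ)
  simp only [p.height_succ, add_sub_cancel_left, add_mul, one_mul, Finset.sum_add_distrib,
    p.sum_rise, add_zero] at h
  rw [area]
  push_cast
  linarith

/-- Every closed step sequence is the step sequence of a touching path. -/
theorem exists_step_eq (s : Fin n → PathStep) (hs : ∑ k, (s k).rise = 0) :
    ∃ p : TouchingPath n, p.step = s := by
  -- The path has the partial sums of the rises as heights, lowered by their minimum `S m` so that
  -- it touches the axis at `m`.
  let S : Fin (n + 1) → ℤ := fun k => ∑ i : Fin n with i.castSucc < k, (s i).rise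
  obtain ⟨m, hm⟩ := Finite.exists_min S
  have hS : ∀ k : Fin n, S k.succ = S k.castSucc + (s k).rise := by
    intro k
    have : (Finset.univ.filter fun i : Fin n => i.castSucc < k.succ) =
        insert k (Finset.univ.filter fun i : Fin n => i.castSucc < k.castSucc) := by
      ext i
      simp only [Finset.mem_filter_univ, Finset.mem_insert, Fin.lt_def, Fin.ext_iff,
        Fin.val_castSucc, Fin.val_succ]
      omega
    simp only [S]
    rw [this, Finset.sum_insert (by simp), add_comm]
  have hcast : ∀ k, (((S k - S m).toNat : ℕ) : ℤ) = S k - S m := fun k =>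
    Int.toNat_of_nonneg (sub_nonneg.2 (hm k))
  refine ⟨⟨fun k => (S k - S m).toNat, s, fun k => ?_, ?_, m, by simp⟩, rfl⟩
  · rw [hcast, hcast, hS]
    ring
  · have h0 : S 0 = 0 := by simp [S]
    have hl : S (Fin.last n) = 0 := by simpa [S, Fin.castSucc_lt_last] using hs
    rw [h0, hl]

/-- Touching paths correspond to closed step sequences. -/
noncomputable def equivClosedSteps (n : ℕ) :
    TouchingPath n ≃ {s : Fin n → PathStep // ∑ k, (s k).rise = 0} :=
  Equiv.ofBijective (fun p => ⟨p.step, p.sum_rise⟩)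
    ⟨fun _ _ h => step_injective (congrArg Subtype.val h),
      fun ⟨s, hs⟩ => (exists_step_eq s hs).imp fun _ h => Subtype.ext h⟩

theorem aeval_areaPolynomial {K : Type*} [Field K] {q : K} {d g : ℕ} (hd : 0 < d)
    (hq : IsPrimitiveRoot q d) :
    aeval q (areaPolynomial (d * g)) = ((2 * g).choose g : K) := by
  rw [← sum_closed_steps hd hq, ← (equivClosedSteps (d * g)).sum_comp, areaPolynomial, map_sum]
  refine Finset.sum_congr rfl fun p _ => ?_
  have hq0 : q ≠ 0 := hq.ne_zero hd.ne'
  have hqn : q ^ (d * g) = 1 := by rw [pow_mul, hq.pow_eq_one, one_pow]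
  rw [map_pow, aeval_X, ← zpow_natCast, area_eq, sub_eq_add_neg, zpow_add₀ hq0, zpow_mul,
    zpow_natCast q, hqn, one_zpow, one_mul]
  rfl

/-- This is the evaluation of the area polynomial at 1, a primitive root of order `d = 1`. -/
theorem card_eq (n : ℕ) : Nat.card (TouchingPath n) = n.centralBinom := by
  have h := aeval_areaPolynomial (K := ℚ) (g := n) one_pos IsPrimitiveRoot.one
  simp only [areaPolynomial, map_sum, map_pow, aeval_X, one_pow, Finset.sum_const, nsmul_eq_mul,
    mul_one, Finset.card_univ, one_mul] at h
  rw [Nat.card_eq_fintype_card]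
  exact_mod_cast h

/-! ### Paths fixed by a rotation -/

theorem step_cyclicShift [NeZero n] (c : ℕ) (p : TouchingPath n) (k : Fin n) :
    (cyclicShift c p).step k = p.step (Fin.ofNat n (k + c)) := rfl

theorem cyclicShift_add [NeZero n] (c d : ℕ) (p : TouchingPath n) :
    cyclicShift c (cyclicShift d p) = cyclicShift (c + d) p := by
  apply step_injective
  funext k
  simp only [step_cyclicShift]
  congr 1
  apply Fin.ext
  simp [Nat.add_assoc]

theorem cyclicShift_zero [NeZero n] (p : TouchingPath n) : cyclicShift 0 p = p := by
  apply step_injective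
  funext k
  simp [step_cyclicShift]

theorem cyclicShift_self [NeZero n] (p : TouchingPath n) : cyclicShift n p = p := by
  apply step_injective
  funext k
  rw [step_cyclicShift]
  congr 1
  apply Fin.ext
  simp [Nat.mod_eq_of_lt k.isLt]

theorem rotation_inv_pow_apply [NeZero n] (j : ℕ) (p : TouchingPath n) :
    ((rotation n)⁻¹ ^ j) p = cyclicShift j p := by
  induction j with
  | zero => rw [pow_zero, cyclicShift_zero]; rfl
  | succ j ih =>
    rw [pow_succ', Equiv.Perm.mul_apply, ih, add_comm j 1, ← cyclicShift_add]
    rfl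

/-- The periods of `p` include `n` and are closed under gcd and multiples. Shifting by `j` is the
inverse of the `j`-th power of the rotation, and a permutation and its inverse have the same fixed
points. -/
theorem rotation_pow_apply_eq_self_iff [NeZero n] (j : ℕ) (p : TouchingPath n) :
    (rotation n ^ j) p = p ↔ cyclicShift (n.gcd j) p = p := by
  have h : ∀ i, Function.IsPeriodicPt ⇑((rotation n)⁻¹) i p ↔ cyclicShift i p = p := fun i => by
    rw [← rotation_inv_pow_apply, Function.IsPeriodicPt, Function.IsFixedPt,
      Equiv.Perm.iterate_eq_pow]
  rw [← h, ← Equiv.Perm.eq_inv_iff_eq, ← inv_pow, rotation_inv_pow_apply, eq_comm, ← h]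
  exact ⟨fun hj => ((h n).2 (cyclicShift_self p)).gcd hj,
    fun hg => hg.trans_dvd (Nat.gcd_dvd_right n j)⟩

theorem sum_rise_comp_modNat {d g : ℕ} (s : Fin g → PathStep) :
    ∑ k : Fin (d * g), (s k.modNat).rise = d * ∑ k, (s k).rise := by
  have h : ∀ k : Fin (d * g), k.modNat = (finProdFinEquiv.symm k).2 := fun _ => rfl
  simp only [h]
  rw [finProdFinEquiv.symm.sum_comp (fun x : Fin d × Fin g => (s x.2).rise),
    Fintype.sum_prod_type]
  simp

theorem step_eq_of_cyclicShift_eq_self {g : ℕ} [NeZero n] {p : TouchingPath n}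
    (hp : cyclicShift g p = p) (k : Fin n) : p.step k = p.step (Fin.ofNat n (k % g)) := by
  have h : ∀ m, cyclicShift (g * m) p = p := fun m => by
    induction m with
    | zero => exact cyclicShift_zero p
    | succ m ih => rw [Nat.mul_succ, ← cyclicShift_add, hp, ih]
  -- Shifting by `g * (k / g)` moves position `k % g` to `k`.
  have hk := congrArg (fun p => step p (Fin.ofNat n (k % g))) (h (k / g))
  simp only [step_cyclicShift] at hk
  rw [← hk]
  congr 1
  apply Fin.ext
  simp only [Fin.val_ofNat, Nat.mod_add_mod, Nat.mod_add_div]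
  rw [Nat.mod_eq_of_lt k.isLt]

/-- Paths of length `d * g` that are invariant under a shift by `g` are repetitions of paths of
length `g`. -/
theorem card_cyclicShift_eq_self (d g : ℕ) [NeZero (d * g)] :
    Nat.card {p : TouchingPath (d * g) // cyclicShift g p = p} = g.centralBinom := by
  have hd : 0 < d := Nat.pos_of_mul_pos_right (Nat.pos_of_neZero (d * g))
  have hsum : ∀ s : Fin g → PathStep,
      ∑ k : Fin (d * g), (s k.modNat).rise = 0 ↔ ∑ k, (s k).rise = 0 := fun s => by
    simp [sum_rise_comp_modNat, hd.ne']
  have hsurj : Function.Surjective (Fin.modNat : Fin (d * g) → Fin g) := fun i =>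
    ⟨finProdFinEquiv (⟨0, hd⟩, i),
      congrArg Prod.snd (finProdFinEquiv.symm_apply_apply ((⟨0, hd⟩ : Fin d), i))⟩
  choose f hf using fun p : TouchingPath g =>
    exists_step_eq (fun k : Fin (d * g) => p.step k.modNat) ((hsum _).2 p.sum_rise)
  have hshift : ∀ p, cyclicShift g (f p) = f p := fun p => by
    apply step_injective
    funext k
    rw [step_cyclicShift, hf]
    refine congrArg p.step (Fin.ext ?_)
    change (k + g) % (d * g) % g = k % g
    rw [Nat.mod_mul_left_mod, Nat.add_mod_right]
  rw [← card_eq]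
  refine (Nat.card_congr (Equiv.ofBijective (fun p => ⟨f p, hshift p⟩) ⟨fun p p' h => ?_, ?_⟩)).symm
  · apply step_injective
    apply hsurj.injective_comp_right
    have h' : f p = f p' := congrArg Subtype.val h
    exact (hf p).symm.trans ((congrArg step h').trans (hf p'))
  · rintro ⟨p, hp⟩
    have hs : p.step = fun k : Fin (d * g) => p.step (Fin.ofNat (d * g) (k.modNat : Fin g)) :=
      funext fun k => step_eq_of_cyclicShift_eq_self hp k
    -- The block of the first `g` steps is closed, because `d > 0` times its total rise is the total
    -- rise of `p`.
    obtain ⟨t, ht⟩ := exists_step_eq (fun i : Fin g => p.step (Fin.ofNat (d * g) i))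
      ((hsum _).1 (by
        have h := p.sum_rise
        rw [hs] at h
        exact h))
    refine ⟨t, Subtype.ext (step_injective ?_)⟩
    rw [hf, ht]
    exact hs.symm

theorem card_fixedBy [NeZero n] (j : ℕ) :
    Nat.card (MulAction.fixedBy (TouchingPath n) (rotationGen n ^ j)) =
      (n.gcd j).centralBinom := by
  obtain ⟨d, hd⟩ := Nat.gcd_dvd_left n j
  have h : Nat.card (MulAction.fixedBy (TouchingPath n) (rotationGen n ^ j)) =
      Nat.card {p : TouchingPath n // cyclicShift (n.gcd j) p = p} :=
    Nat.card_congr (Equiv.subtypeEquivRight fun p => rotation_pow_apply_eq_self_iff j p)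
  rw [h]
  generalize n.gcd j = g at hd
  rw [mul_comm] at hd
  subst hd
  exact card_cyclicShift_eq_self d g

/-- A trivial power `m` with `0 < m < n` would fix every path, so `n` and `n.gcd m` would have the
same central binomial coefficient. Strict monotonicity then forces `n.gcd m = n`, although `n.gcd m
≤ m < n`. -/
theorem orderOf_rotation (n : ℕ) [NeZero n] : orderOf (rotation n) = n := by
  have hn := Nat.pos_of_neZero n
  rw [orderOf_eq_iff hn]
  refine ⟨Equiv.ext fun p => ?_, fun m hm hm0 h => ?_⟩
  · refine (rotation_pow_apply_eq_self_iff n p).2 ?_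
    rw [Nat.gcd_self, cyclicShift_self]
  · have h1 : MulAction.fixedBy (TouchingPath n) (rotationGen n ^ m) = Set.univ :=
      Set.eq_univ_of_forall fun p => Equiv.congr_fun h p
    have h2 := card_fixedBy (n := n) m
    rw [h1, Nat.card_congr (Equiv.Set.univ _), card_eq] at h2
    exact absurd (Nat.le_of_dvd hm0 (Nat.gcd_dvd_right n m))
      (by rw [← Nat.centralBinom_strictMono.injective h2]; omega)

end TouchingPath

theorem proposition6p1 (n : ℕ) [NeZero n] :
    ExhibitsCyclicSieving (TouchingPath n) (TouchingPath.rotationGen n) n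
        (TouchingPath.areaPolynomial n) ∧
      ∀ j < n, Nat.card (MulAction.fixedBy (TouchingPath n) (TouchingPath.rotationGen n ^ j)) =
        Nat.choose (2 * Nat.gcd n j) (Nat.gcd n j) := by
  have hn := Nat.pos_of_neZero n
  have hfix := fun j => TouchingPath.card_fixedBy (n := n) j
  simp only [Nat.centralBinom_eq_two_mul_choose] at hfix
  refine ⟨⟨inferInstance, hn, ?_, ?_, fun j _ => ?_⟩, fun j _ => hfix j⟩
  · rw [Nat.card_zpowers, TouchingPath.orderOf_rotation]
  · rw [Subgroup.eq_top_iff']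
    rintro ⟨_, k, rfl⟩
    exact ⟨k, Subtype.ext rfl⟩
  · have hg : 0 < n.gcd j := Nat.gcd_pos_of_pos_left j hn
    have hd : 0 < n / n.gcd j := Nat.div_pos (Nat.gcd_le_left j hn) hg
    have hζ := Complex.isPrimitiveRoot_exp n hn.ne'
    -- The power `ξ_n ^ j` is a primitive root of order `n / n.gcd j`, so `d * g = n` with `g =
    -- n.gcd j`.
    have hq := IsPrimitiveRoot.orderOf (Complex.exp (2 * Real.pi * Complex.I / n) ^ j)
    rw [IsOfFinOrder.orderOf_pow _ _ (isOfFinOrder_iff_pow_eq_one.2 ⟨n, hn, hζ.pow_eq_one⟩),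
      ← hζ.eq_orderOf] at hq
    have h := TouchingPath.aeval_areaPolynomial (g := n.gcd j) hd hq
    rw [Nat.div_mul_cancel (Nat.gcd_dvd_left n j)] at h
    rw [h, hfix]
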